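/- Let $G$ be a finitely presentable group of deficiency at least $d \in \mathbb{Z}$, where the deficiency of a finite presentation with $n$ generators and $m$ relators is $n-m$, and the deficiency of $G$ is the maximum of the deficiencies of its finite presentations. For a prime $p$ and a group $\Gamma$ write $b_1(\Gamma;\mathbb{F}_p)=\dim_{\mathbb{F}_p} H_1(\Gamma;\mathbb{F}_p)$, and for integers $r, j\ge 0$ let $|\Omega^j_{p,r}|$ denote the coefficient of $x^j$ in the polynomial $(1+x+\cdots+x^{p-1})^r$. Then for every prime $p$, every integer $r\ge 0$ and every normal subgroup $N$ of $G$ with $G/N\cong(\mathbb{Z}/p)^r$, $$ b_1(N;\mathbb{F}_p)\;\ge\; 1+b_1(G;\mathbb{F}_p)\,|\Omega^k_{p,r}|+d\sum_{j=0}^{k-1}|\Omega^j_{p,r}|-p^r \qquad\text{for all integers } 0\le k\le r(p-1). $$ In particular, if $G/N\cong(\mathbb{Z}/2)^r$, then $$ b_1(N;\mathbb{F}_2)\;\ge\; 1+b_1(G;\mathbb{F}_2)\binom{r}{k}+d\sum_{j=0}^{k-1}\binom{r}{j}-2^r \qquad\text{for all integers } 0\le k\le r. $$ -/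

import Mathlib

/-- A finite presentation `⟨a₁, …, aₙ ∣ R₁, …, Rₘ⟩` of a group `G`: a family of `m` words in the free
group on `n` letters (repetitions count), together with an isomorphism of the presented group
with `G`. -/
structure FinitePresentation (G : Type*) [Group G] where
  /-- the number of generators -/
  n : ℕ
  /-- the number of relators -/
  m : ℕ
  /-- the relators -/
  relator : Fin m → FreeGroup (Fin n)
  /-- the presented group is `G` -/
  equiv : PresentedGroup (Set.range relator) ≃* G

/-- The deficiency of a finite presentation: generators minus relators. -/
def FinitePresentation.deficiency {G : Type*} [Group G] (P : FinitePresentation G) : ℤ :=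
  (P.n : ℤ) - (P.m : ℤ)

/-- The deficiency of a group: the supremum over all its finite presentations of the deficiency
of the presentation. It is taken in the complete linear order `ℤ ∪ {±∞}`, so that no
boundedness has to be known beforehand (and it is `-∞` if there is no finite presentation). -/
noncomputable def groupDeficiency (G : Type*) [Group G] : WithBot (WithTop ℤ) :=
  ⨆ P : FinitePresentation G, ((P.deficiency : WithTop ℤ) : WithBot (WithTop ℤ))

/-- `G` has deficiency at least the integer `d` exactly when some finite presentation has. -/
theorem le_groupDeficiency_iff {G : Type*} [Group G] (d : ℤ) :
    ((d : WithTop ℤ) : WithBot (WithTop ℤ)) ≤ groupDeficiency G ↔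
      ∃ P : FinitePresentation G, d ≤ P.deficiency := by
  constructor
  · intro h
    have h1 : (((d - 1 : ℤ) : WithTop ℤ) : WithBot (WithTop ℤ)) < groupDeficiency G :=
      lt_of_lt_of_le (WithBot.coe_lt_coe.2 (WithTop.coe_lt_coe.2 (by omega))) h
    obtain ⟨P, hP⟩ := lt_iSup_iff.1 h1
    have h2 : d - 1 < P.deficiency := WithTop.coe_lt_coe.1 (WithBot.coe_lt_coe.1 hP)
    exact ⟨P, by omega⟩
  · rintro ⟨P, hP⟩
    exact le_trans (WithBot.coe_le_coe.2 (WithTop.coe_le_coe.2 hP))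
      (le_iSup (fun P : FinitePresentation G =>
        ((P.deficiency : WithTop ℤ) : WithBot (WithTop ℤ))) P)

/-- `b₁(G; 𝔽_p) = dim H₁(G; 𝔽_p)`, the dimension over `𝔽_p` of the first group homology with trivial
coefficients. The field `𝔽_p` is lifted to the universe of `G`, as group homology in Mathlib
takes the ring and the group in the same universe. -/
noncomputable def bettiOne.{u} (p : ℕ) (G : Type u) [Group G] : ℕ :=
  Module.finrank (ULift.{u} (ZMod p))
    (groupHomology (Rep.trivial (ULift.{u} (ZMod p)) G (ULift.{u} (ZMod p))) 1)

/-- `|Ω^j_{p,r}|`: the coefficient of `x^j` in `(1 + x + ⋯ + x^(p-1))^r`. -/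
noncomputable def omegaCard (p r j : ℕ) : ℕ :=
  (((∑ i ∈ Finset.range p, Polynomial.X ^ i : Polynomial ℕ)) ^ r).coeff j

/-!
Let `K = 𝔽_p`, let `V = Kʳ` be the quotient `G ⧸ N`, acting by translation on the functions `V → K`, and
take a presentation of `G` with `n` generators and `m` relators. The proof counts the derivations
from `G` to `V → K` in two ways.

*Upper bound* (`derivations.exists_injective`). By Shapiro's lemma the first cohomology of `G` in
`V → K` is `Hom(N, K)`, and the inner derivations have dimension `pʳ - 1`. Concretely, a derivation is
determined by `δ g 0` for all `g`, hence by its restriction to `N` evaluated at `0`, which is a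
homomorphism `N → K`, and by its values at representatives of the `pʳ - 1` nontrivial cosets.

*Lower bound* (`finrank_hom_subgroup_ge`). A derivation of the free group is given by arbitrary values
at the generators (`derivations.freeEquiv`), and it comes from `G` once it vanishes at the relators
(`derivations.mem_range_pullback`). Let `U` and `C` be the spaces of polynomial functions on `V` of
degree less than `k` and homogeneous of degree `k`. Translations preserve `U` and act trivially on `C`
modulo `U`. Prescribe at the generators the sum of an arbitrary element of `U` and of the value of a
homomorphism `G → C`. Such derivations form a space of dimension `n dim U + b₁(G) dim C`. Modulo `U`
they are homomorphisms trivial on the relators (`derivations.sub_hom_mem`), so vanishing at the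
relators is only `m dim U` conditions.

Comparing gives `(n - m) dim U + b₁(G) dim C ≤ b₁(N) + pʳ - 1`. Monomials with all exponents less than
`p` are linearly independent functions, and those of degree `j` are counted by the coefficient of `x^j`
in `(1 + x + ⋯ + x^(p-1))ʳ`, which identifies the dimensions.
-/

/-! ### Monomial functions on affine space over a finite field -/

section MonomialFunctions

variable {ι : Type*} [Fintype ι] (K : Type*) [Field K]

/-- The monomial `x ↦ ∏ i, x i ^ a i`, as a function on `ι → K`. -/
def monomialFun (a : ι → ℕ) : (ι → K) → K := fun x => ∏ i, x i ^ a i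

variable (ι) in
/-- The exponents of reduced monomials, all entries being less than `q`. -/
def reducedExps [DecidableEq ι] (q : ℕ) : Finset (ι → ℕ) :=
  Fintype.piFinset fun _ => Finset.range q

variable (ι) in
/-- The span of the reduced monomials of total degree less than `k`. -/
def polyLT [DecidableEq ι] (q k : ℕ) : Submodule K ((ι → K) → K) :=
  Submodule.span K (monomialFun K '' {a | a ∈ reducedExps ι q ∧ ∑ i, a i < k})

variable (ι) in
/-- The span of the reduced monomials of total degree exactly `k`. -/
def polyHomogeneous [DecidableEq ι] (q k : ℕ) : Submodule K ((ι → K) → K) :=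
  Submodule.span K (monomialFun K '' {a | a ∈ reducedExps ι q ∧ ∑ i, a i = k})

/-- Translation of functions by `h`. -/
def translateFun (K : Type*) [Field K] {V : Type*} [AddCommGroup V] (h : V) :
    (V → K) →ₗ[K] (V → K) :=
  LinearMap.funLeft K K (· + h)

@[simp]
theorem translateFun_apply {V : Type*} [AddCommGroup V] (h : V) (f : V → K) (x : V) :
    translateFun K h f x = f (x + h) := rfl

variable [DecidableEq ι]

/-- Translation changes a monomial only in lower degree: in the expansion of `(x + h) ^ a` the
leading term is `x ^ a`, and the others are reduced monomials of smaller degree. -/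
theorem translateFun_monomialFun_sub_mem {q : ℕ} {a : ι → ℕ} (ha : a ∈ reducedExps ι q)
    (h : ι → K) :
    translateFun K h (monomialFun K a) - monomialFun K a ∈ polyLT ι K q (∑ i, a i) := by
  have key : translateFun K h (monomialFun K a)
      = ∑ b ∈ Fintype.piFinset fun i => Finset.range (a i + 1),
          (∏ i, h i ^ (a i - b i) * ((a i).choose (b i) : K)) • monomialFun K b := by
    funext x
    simp only [translateFun_apply, monomialFun, Finset.sum_apply, Pi.smul_apply, smul_eq_mul,
      Pi.add_apply, add_pow, Finset.prod_univ_sum, ← Finset.prod_mul_distrib]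
    exact Finset.sum_congr rfl fun b _ => Finset.prod_congr rfl fun i _ => by ring
  have hmem : a ∈ Fintype.piFinset fun i => Finset.range (a i + 1) := by simp
  rw [key, ← Finset.add_sum_erase _ _ hmem]
  simp only [Nat.sub_self, pow_zero, Nat.choose_self, Nat.cast_one, mul_one, Finset.prod_const_one,
    one_smul, add_sub_cancel_left]
  refine Submodule.sum_mem _ fun b hb => Submodule.smul_mem _ _ (Submodule.subset_span ⟨b, ?_, rfl⟩)
  simp only [Finset.mem_erase, Fintype.mem_piFinset, Finset.mem_range, Nat.lt_succ_iff] at hb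
  obtain ⟨hne, hle⟩ := hb
  refine ⟨?_, ?_⟩
  · simp only [reducedExps, Fintype.mem_piFinset, Finset.mem_range] at ha ⊢
    exact fun i => (hle i).trans_lt (ha i)
  · obtain ⟨i, hi⟩ := Function.ne_iff.1 hne
    exact Finset.sum_lt_sum (fun i _ => hle i) ⟨i, Finset.mem_univ i, lt_of_le_of_ne (hle i) hi⟩

theorem polyLT_mono (q : ℕ) {k l : ℕ} (h : k ≤ l) : polyLT ι K q k ≤ polyLT ι K q l :=
  Submodule.span_mono (Set.image_mono fun _ ha => ⟨ha.1, ha.2.trans_le h⟩)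

theorem translateFun_mem_polyLT {q k : ℕ} (h : ι → K) {f : (ι → K) → K} (hf : f ∈ polyLT ι K q k) :
    translateFun K h f ∈ polyLT ι K q k := by
  suffices polyLT ι K q k ≤ (polyLT ι K q k).comap (translateFun K h) from this hf
  refine Submodule.span_le.2 ?_
  rintro _ ⟨a, ⟨ha, hk⟩, rfl⟩
  have h1 := polyLT_mono K q hk.le (translateFun_monomialFun_sub_mem K ha h)
  have h2 : monomialFun K a ∈ polyLT ι K q k := Submodule.subset_span ⟨a, ⟨ha, hk⟩, rfl⟩
  simpa using add_mem h1 h2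

theorem translateFun_sub_mem_polyLT {q k : ℕ} (h : ι → K) {f : (ι → K) → K}
    (hf : f ∈ polyHomogeneous ι K q k) : translateFun K h f - f ∈ polyLT ι K q k := by
  suffices polyHomogeneous ι K q k ≤ (polyLT ι K q k).comap (translateFun K h - LinearMap.id) from
    this hf
  refine Submodule.span_le.2 ?_
  rintro _ ⟨a, ⟨ha, rfl⟩, rfl⟩
  exact translateFun_monomialFun_sub_mem K ha h

variable [Fintype K]

/-- Reduced monomials are linearly independent as functions, since a polynomial of degree less than
`|K|` in each variable that vanishes everywhere is zero. -/
theorem linearIndepOn_monomialFun :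
    LinearIndepOn K (monomialFun K) (reducedExps ι (Fintype.card K) : Set (ι → ℕ)) := by
  rw [linearIndepOn_finset_iff]
  intro c hc a ha
  set s := reducedExps ι (Fintype.card K)
  let P : MvPolynomial ι K := ∑ b ∈ s, MvPolynomial.monomial (Finsupp.equivFunOnFinite.symm b) (c b)
  have hP : P = 0 := by
    refine MvPolynomial.eq_zero_of_eval_zero_at_prod_finset P (fun _ => Finset.univ) ?_ ?_
    · intro i
      have hpos : 0 < Fintype.card K := Fintype.card_pos
      rw [Finset.card_univ, MvPolynomial.degreeOf_lt_iff hpos]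
      intro m hm
      obtain ⟨b, hb, hbm⟩ := Finset.mem_biUnion.1 (MvPolynomial.support_sum hm)
      have := MvPolynomial.support_monomial_subset hbm
      rw [Finset.mem_singleton] at this
      subst this
      simp only [s, reducedExps, Fintype.mem_piFinset, Finset.mem_range] at hb
      exact hb i
    · intro x _
      have := congrFun hc x
      simp only [Finset.sum_apply, Pi.smul_apply, smul_eq_mul, Pi.zero_apply] at this
      simp only [P, map_sum, MvPolynomial.eval_monomial]
      rw [← this]
      refine Finset.sum_congr rfl fun b _ => ?_
      rw [Finsupp.prod_fintype _ _ (fun _ => pow_zero _)]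
      rfl
  have := congrArg (MvPolynomial.coeff (Finsupp.equivFunOnFinite.symm a)) hP
  simpa [P, MvPolynomial.coeff_sum, MvPolynomial.coeff_monomial, ha] using this

variable (ι)

theorem finrank_span_monomialFun (Q : (ι → ℕ) → Prop) [DecidablePred Q] :
    Module.finrank K (Submodule.span K
      (monomialFun K '' {a | a ∈ reducedExps ι (Fintype.card K) ∧ Q a}))
      = ((reducedExps ι (Fintype.card K)).filter Q).card := by
  have h := (linearIndepOn_monomialFun (ι := ι) K).mono
    (t := {a | a ∈ reducedExps ι (Fintype.card K) ∧ Q a}) fun a ha => ha.1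
  rw [Set.image_eq_range, finrank_span_eq_card h, ← Set.toFinset_card]
  congr 1
  ext a
  simp

theorem disjoint_polyLT_polyHomogeneous (k : ℕ) :
    Disjoint (polyLT ι K (Fintype.card K) k) (polyHomogeneous ι K (Fintype.card K) k) := by
  set s : Set (ι → ℕ) := (reducedExps ι (Fintype.card K) : Set (ι → ℕ))
  have h : ∀ Q : (ι → ℕ) → Prop, {a | a ∈ reducedExps ι (Fintype.card K) ∧ Q a}
      = ((↑) : s → ι → ℕ) '' {a | Q a} := by
    intro Q
    ext a
    simp [s, and_comm]
  have hd := (linearIndepOn_monomialFun (ι := ι) K).linearIndependent.disjoint_span_image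
    (s := {a | ∑ i, a.1 i < k}) (t := {a | ∑ i, a.1 i = k})
    (Set.disjoint_left.2 fun a h1 h2 => (ne_of_lt h1) h2)
  rw [polyLT, polyHomogeneous, h, h, ← Set.image_comp, ← Set.image_comp]
  exact hd

end MonomialFunctions

/-! ### The coefficients of `(1 + x + ⋯ + x^(p-1))^r` count reduced monomials -/

theorem omegaCard_eq_card (p r j : ℕ) :
    omegaCard p r j = ((reducedExps (Fin r) p).filter fun a => ∑ i, a i = j).card := by
  have h : (∑ i ∈ Finset.range p, Polynomial.X ^ i : Polynomial ℕ) ^ r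
      = ∑ a ∈ reducedExps (Fin r) p, Polynomial.X ^ (∑ i, a i) := by
    calc _ = ∏ _i : Fin r, ∑ l ∈ Finset.range p, (Polynomial.X : Polynomial ℕ) ^ l := by simp
      _ = _ := by
        rw [Finset.prod_univ_sum]
        simp only [Finset.prod_pow_eq_pow_sum, reducedExps]
  rw [omegaCard, h, Polynomial.finsetSum_coeff]
  simp only [Polynomial.coeff_X_pow, Finset.card_filter, eq_comm]

theorem sum_omegaCard_eq_card (p r k : ℕ) :
    ∑ j ∈ Finset.range k, omegaCard p r j
      = ((reducedExps (Fin r) p).filter fun a => ∑ i, a i < k).card := by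
  simp only [omegaCard_eq_card]
  rw [Finset.card_eq_sum_card_fiberwise (f := fun a => ∑ i, a i) (t := Finset.range k)
    (fun a ha => by simpa using (Finset.mem_filter.1 ha).2)]
  refine Finset.sum_congr rfl fun j hj => ?_
  rw [Finset.filter_filter]
  congr 1
  refine Finset.filter_congr fun a _ => ?_
  have := Finset.mem_range.1 hj
  constructor
  · intro h; exact ⟨h ▸ this, h⟩
  · exact fun h => h.2

theorem omegaCard_two (r k : ℕ) : omegaCard 2 r k = r.choose k := by
  simp [omegaCard, Finset.sum_range_succ, Polynomial.coeff_one_add_X_pow]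

/-! ### Derivations with values in functions on a finite quotient -/

section Derivations

variable {Γ V : Type*} [Group Γ] [AddCommGroup V] (K : Type*) [Field K]

/-- The derivations from `Γ` to the functions `V → K`, where `Γ` acts on these functions by
translation through `π`: the maps with `δ (g * h) = δ g + g • δ h`. As `V` is commutative, translation
of the argument by `π g` is a left action. -/
def derivations (π : Γ →* Multiplicative V) : Submodule K (Γ → V → K) where
  carrier := {δ | ∀ g h, δ (g * h) = δ g + translateFun K (π g).toAdd (δ h)}
  zero_mem' := fun g h => by simp
  add_mem' := fun {δ ε} hδ hε g h => by
    simp only [Pi.add_apply, hδ g h, hε g h, map_add]; abel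
  smul_mem' := fun c δ hδ g h => by
    simp only [Pi.smul_apply, hδ g h, map_smul, smul_add]

variable {K}

theorem translateFun_add (g h : V) (f : V → K) :
    translateFun K (g + h) f = translateFun K g (translateFun K h f) := by
  funext x; simp [add_assoc]

@[simp]
theorem translateFun_zero (f : V → K) : translateFun K (0 : V) f = f := by
  funext x; simp

@[simp]
theorem translateFun_neg_translate (g : V) (f : V → K) :
    translateFun K (-g) (translateFun K g f) = f := by
  funext x; simp

@[simp]
theorem translateFun_translate_neg (g : V) (f : V → K) :
    translateFun K g (translateFun K (-g) f) = f := by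
  funext x; simp

variable {π : Γ →* Multiplicative V}

theorem derivations.apply_mul {δ : Γ → V → K} (hδ : δ ∈ derivations K π) (g h : Γ) :
    δ (g * h) = δ g + translateFun K (π g).toAdd (δ h) := hδ g h

theorem derivations.apply_one {δ : Γ → V → K} (hδ : δ ∈ derivations K π) : δ 1 = 0 := by
  have := hδ 1 1
  simpa using this

theorem derivations.apply_inv {δ : Γ → V → K} (hδ : δ ∈ derivations K π) (g : Γ) :
    δ g⁻¹ = -translateFun K (-(π g).toAdd) (δ g) := by
  have h := hδ g⁻¹ g
  rw [inv_mul_cancel, derivations.apply_one hδ, map_inv, toAdd_inv] at h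
  exact eq_neg_of_add_eq_zero_left h.symm

/-- A derivation of a free group that agrees modulo `U` on the generators with a homomorphism
to a space `C` of functions that are translation invariant modulo `U` agrees with it modulo `U`
everywhere. With `U = C = ⊥` this says that a derivation vanishing on the generators is zero. -/
theorem derivations.sub_hom_mem {α : Type*} {π : FreeGroup α →* Multiplicative V}
    {δ : FreeGroup α → V → K} (hδ : δ ∈ derivations K π) {U C : Submodule K (V → K)}
    (hU : ∀ h, ∀ f ∈ U, translateFun K h f ∈ U) (hC : ∀ h, ∀ f ∈ C, translateFun K h f - f ∈ U)
    (ψ : Additive (FreeGroup α) →+ (V → K)) (hψ : ∀ w, ψ w ∈ C)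
    (h : ∀ i, δ (FreeGroup.of i) - ψ (.ofMul (FreeGroup.of i)) ∈ U) (w : FreeGroup α) :
    δ w - ψ (.ofMul w) ∈ U := by
  induction w using FreeGroup.induction_on with
  | C1 => simp [derivations.apply_one hδ]
  | of i => exact h i
  | inv_of i hi =>
    have h1 := U.neg_mem (hU (-(π (FreeGroup.of i)).toAdd) _ hi)
    have h2 := hC (-(π (FreeGroup.of i)).toAdd) _ (hψ (.ofMul (FreeGroup.of i)))
    have h3 := U.sub_mem h1 h2
    change δ (FreeGroup.of i)⁻¹ - _ ∈ U
    rw [derivations.apply_inv hδ, ofMul_inv, map_neg]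
    convert h3 using 1
    rw [map_sub]
    abel
  | mul x y hx hy =>
    have h1 := hU (π x).toAdd _ hy
    have h2 := hC (π x).toAdd _ (hψ (.ofMul y))
    have h3 := U.add_mem (U.add_mem hx h1) h2
    rw [derivations.apply_mul hδ, ofMul_mul, map_add]
    convert h3 using 1
    rw [map_sub]
    abel

/-- Values of a derivation of a free group at generators can be prescribed. -/
theorem derivations.exists_free {α : Type*} (π : FreeGroup α →* Multiplicative V)
    (v : α → V → K) : ∃ δ ∈ derivations K π, ∀ i, δ (FreeGroup.of i) = v i := by
  -- The affine maps `f ↦ g • f + δ g` compose according to the derivation rule.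
  let A : FreeGroup α →* Equiv.Perm (V → K) := FreeGroup.lift fun i =>
    { toFun := fun f => v i + translateFun K (π (FreeGroup.of i)).toAdd f
      invFun := fun f => translateFun K (-(π (FreeGroup.of i)).toAdd) (f - v i)
      left_inv := fun f => by simp
      right_inv := fun f => by simp }
  have hA : ∀ w f, A w f = A w 0 + translateFun K (π w).toAdd f := by
    intro w
    induction w using FreeGroup.induction_on with
    | C1 => simp
    | of i => intro f; simp [A]
    | inv_of i hi =>
      intro f
      simp [A, Equiv.Perm.inv_def, sub_eq_neg_add]
    | mul x y hx hy =>
      intro f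
      rw [map_mul, Equiv.Perm.mul_apply, Equiv.Perm.mul_apply, hx, hx (A y 0), hy f, map_mul,
        toAdd_mul, translateFun_add, map_add, add_assoc]
  refine ⟨fun w => A w 0, fun g h => ?_, fun i => by simp [A]⟩
  change A (g * h) 0 = _
  rw [map_mul, Equiv.Perm.mul_apply, hA]

/-- A derivation of a free group is determined by its values at the generators, which are
arbitrary. -/
noncomputable def derivations.freeEquiv {α : Type*} (π : FreeGroup α →* Multiplicative V) :
    derivations K π ≃ₗ[K] (α → V → K) :=
  LinearEquiv.ofBijective
    ((LinearMap.funLeft K (V → K) FreeGroup.of).comp (derivations K π).subtype) <| by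
    constructor
    · rw [injective_iff_map_eq_zero]
      intro δ hδ
      ext1
      funext w
      have := derivations.sub_hom_mem δ.2 (U := ⊥) (C := ⊥) (by simp) (by simp) 0 (by simp)
        (fun i => by simpa using congrFun hδ i) w
      simpa using this
    · intro v
      obtain ⟨δ, hδ, h⟩ := derivations.exists_free π v
      exact ⟨⟨δ, hδ⟩, funext h⟩

theorem derivations.freeEquiv_apply {α : Type*} (π : FreeGroup α →* Multiplicative V)
    (δ : derivations K π) (i : α) : freeEquiv π δ i = δ.1 (FreeGroup.of i) := rfl

/-- Pulling derivations back along a homomorphism. -/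
def derivations.pullback {Δ : Type*} [Group Δ] (θ : Δ →* Γ) (π : Γ →* Multiplicative V) :
    derivations K π →ₗ[K] derivations K (π.comp θ) :=
  ((LinearMap.funLeft K (V → K) θ).comp (derivations K π).subtype).codRestrict _ fun δ g h => by
    simpa using δ.2 (θ g) (θ h)

/-- A derivation that vanishes on elements whose normal closure is the kernel of a surjection `θ`
factors through `θ`. -/
theorem derivations.mem_range_pullback {Δ : Type*} [Group Δ] {θ : Δ →* Γ}
    (hθ : Function.Surjective θ) {R : Set Δ} (hR : θ.ker = Subgroup.normalClosure R)
    (δ : derivations K (π.comp θ)) (h0 : ∀ w ∈ R, δ.1 w = 0) :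
    δ ∈ LinearMap.range (pullback (K := K) θ π) := by
  obtain ⟨δ, hδ⟩ := δ
  -- The derivations in the kernel of `T` vanish at all relators, so come from `G`.
  have hker : ∀ w, θ w = 1 → δ w = 0 := by
    let Z : Subgroup Δ :=
      { carrier := {w | θ w = 1 ∧ δ w = 0}
        one_mem' := ⟨map_one θ, apply_one hδ⟩
        mul_mem' := fun {a b} ha hb => by
          refine ⟨by rw [map_mul, ha.1, hb.1, one_mul], ?_⟩
          rw [apply_mul hδ, ha.2, hb.2, map_zero, add_zero]
        inv_mem' := fun {a} ha => by
          refine ⟨by rw [map_inv, ha.1, inv_one], ?_⟩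
          rw [apply_inv hδ, ha.2, map_zero, neg_zero] }
    have hZ : Z.Normal := ⟨fun w hw g => by
      refine ⟨by simp [hw.1], ?_⟩
      rw [apply_mul hδ, apply_mul hδ, hw.2, apply_inv hδ]
      simp [hw.1]⟩
    have : θ.ker ≤ Z := by
      rw [hR]
      refine Subgroup.normalClosure_le_normal fun w hw => ⟨?_, h0 w hw⟩
      have : w ∈ θ.ker := hR ▸ Subgroup.subset_normalClosure hw
      exact this
    exact fun w hw => (this hw).2
  have hcongr : ∀ a b, θ a = θ b → δ a = δ b := by
    intro a b hab
    have h1 := apply_mul hδ a (a⁻¹ * b)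
    rw [hker (a⁻¹ * b) (by simp [hab]), map_zero, add_zero, mul_inv_cancel_left] at h1
    exact h1.symm
  let s := Function.surjInv hθ
  have hs : ∀ g, θ (s g) = g := Function.surjInv_eq hθ
  refine ⟨⟨fun g => δ (s g), fun g h => ?_⟩, ?_⟩
  · have h1 := apply_mul hδ (s g) (s h)
    rw [MonoidHom.comp_apply, hs] at h1
    rw [← h1]
    exact hcongr _ _ (by simp [hs])
  · ext1
    funext w
    exact hcongr _ _ (hs _)

/-- If `N` is the kernel of the surjection `π`, derivations embed into the sum of `Hom(N, K)` and a
space of dimension `|V| - 1`. This is the half of Shapiro's lemma `H¹(N, K) = H¹(Γ, V → K)` that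
bounds `Hom(N, K)` from below. -/
theorem derivations.exists_injective (N : Subgroup Γ) (hN : ∀ g, g ∈ N ↔ π g = 1)
    (hπ : Function.Surjective π) :
    ∃ L : derivations K π →ₗ[K] (Additive N →+ K) × ({v : V // v ≠ 0} → K),
      Function.Injective L := by
  let s : V → Γ := fun v => Function.surjInv hπ (.ofAdd v)
  have hs : ∀ v, π (s v) = .ofAdd v := fun v => Function.surjInv_eq hπ _
  let L₁ : derivations K π →ₗ[K] (Additive N →+ K) :=
    { toFun := fun δ =>
        { toFun := fun n => δ.1 n.toMul 0
          map_zero' := congrFun (apply_one δ.2) 0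
          map_add' := fun a b => by
            have h := congrFun (apply_mul δ.2 (a.toMul : Γ) b.toMul) 0
            rw [(hN _).1 a.toMul.2] at h
            simpa using h }
      map_add' := fun _ _ => rfl
      map_smul' := fun _ _ => rfl }
  let L₂ : derivations K π →ₗ[K] ({v : V // v ≠ 0} → K) :=
    { toFun := fun δ v => δ.1 (s v) 0
      map_add' := fun _ _ => rfl
      map_smul' := fun _ _ => rfl }
  -- The numbers `δ g 0` determine `δ`, as `δ (g * h) 0 = δ g 0 + δ h (π g)`.
  refine ⟨L₁.prod L₂, ?_⟩
  rw [injective_iff_map_eq_zero]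
  intro δ hδ
  have h₁ : ∀ n ∈ N, δ.1 n 0 = 0 := fun n hn =>
    DFunLike.congr_fun (congrArg Prod.fst hδ) (Additive.ofMul (⟨n, hn⟩ : N))
  have h₂ : ∀ v, v ≠ 0 → δ.1 (s v) 0 = 0 := fun v hv => congrFun (congrArg Prod.snd hδ) ⟨v, hv⟩
  have h₃ : ∀ g, δ.1 g 0 = 0 := by
    intro g
    by_cases hg : π g = 1
    · exact h₁ g ((hN g).2 hg)
    · have hn : g * (s (π g).toAdd)⁻¹ ∈ N := (hN _).2 (by simp [hs])
      have h := congrFun (apply_mul δ.2 (g * (s (π g).toAdd)⁻¹) (s (π g).toAdd)) 0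
      rw [inv_mul_cancel_right, (hN _).1 hn] at h
      rw [h]
      simp [h₁ _ hn, h₂ _ (show (π g).toAdd ≠ 0 from hg)]
  ext1
  funext h x
  obtain ⟨g, hg⟩ := hπ (.ofAdd x)
  have := congrFun (apply_mul δ.2 g h) 0
  simpa [h₃, hg] using this.symm

end Derivations

/-! ### Counting derivations of a presented group -/

theorem Group.FG.finite_addMonoidHom (Γ : Type*) [Group Γ] [Group.FG Γ] (K : Type*) [Field K] :
    Module.Finite K (Additive Γ →+ K) := by
  obtain ⟨S, hS⟩ := (AddGroup.fg_def.1 (inferInstance : AddGroup.FG (Additive Γ)))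
  let ev : (Additive Γ →+ K) →ₗ[K] (S → K) :=
    { toFun := fun φ s => φ s
      map_add' := fun _ _ => rfl
      map_smul' := fun _ _ => rfl }
  refine Module.Finite.of_injective ev fun φ ψ h => ?_
  exact AddMonoidHom.eq_of_eqOn_dense hS fun s hs => congrFun h ⟨s, hs⟩

/-- For every translation invariant space `U` of functions and every space `C`, independent of `U`,
of functions that are translation invariant modulo `U`, counting derivations of `G` bounds
`dim Hom(N, K)` from below. -/
theorem finrank_hom_subgroup_ge {G V K : Type*} [Group G] [AddCommGroup V] [Finite V]
    [Field K] {n m : ℕ} {θ : FreeGroup (Fin n) →* G} (hθ : Function.Surjective θ)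
    {R : Fin m → FreeGroup (Fin n)} (hR : θ.ker = Subgroup.normalClosure (Set.range R))
    {π : G →* Multiplicative V} (hπ : Function.Surjective π)
    {N : Subgroup G} (hN : ∀ g, g ∈ N ↔ π g = 1) {U C : Submodule K (V → K)}
    (hU : ∀ h, ∀ f ∈ U, translateFun K h f ∈ U) (hC : ∀ h, ∀ f ∈ C, translateFun K h f - f ∈ U)
    (hUC : Disjoint U C) :
    n * Module.finrank K U + Module.finrank K (Additive G →+ K) * Module.finrank K C + 1
      ≤ Module.finrank K (Additive N →+ K) + Nat.card V + m * Module.finrank K U := by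
  have : Group.FG G := Group.fg_of_surjective hθ
  have := Group.FG.finite_addMonoidHom G K
  let b := Module.finBasis K (Additive G →+ K)
  set B := Module.finrank K (Additive G →+ K)
  let E := derivations.freeEquiv (K := K) (π.comp θ)
  -- `Hom(G, K) ⊗ C` as homomorphisms from `G` to `C`, in coordinates given by the basis `b`.
  let homPart : (Fin B → C) →ₗ[K] (G → V → K) :=
    { toFun := fun c g => ∑ l, b l (.ofMul g) • (c l : V → K)
      map_add' := fun c c' => by
        funext g; simp [smul_add, Finset.sum_add_distrib]
      map_smul' := fun t c => by
        funext g; simp [Finset.smul_sum, smul_comm t] }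
  have homPart_mul : ∀ c g h, homPart c (g * h) = homPart c g + homPart c h := by
    intro c g h
    simp [homPart, add_smul, Finset.sum_add_distrib]
  have homPart_mem : ∀ c g, homPart c g ∈ C := fun c g =>
    Submodule.sum_mem C (t := Finset.univ) (f := fun l => b l (.ofMul g) • (c l : V → K))
      fun l _ => C.smul_mem _ (c l).2
  let ψ : (Fin B → C) → Additive (FreeGroup (Fin n)) →+ (V → K) := fun c =>
    AddMonoidHom.mk' (fun w => homPart c (θ w.toMul)) fun x y => by
      rw [toMul_add, map_mul, homPart_mul]
  let Φ : ((Fin n → U) × (Fin B → C)) →ₗ[K] (Fin n → V → K) :=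
    LinearMap.coprod (LinearMap.compLeft U.subtype (Fin n))
      ((LinearMap.funLeft K (V → K) fun i => θ (FreeGroup.of i)).comp homPart)
  have hΦ : ∀ u c i, Φ (u, c) i = (u i : V → K) + homPart c (θ (FreeGroup.of i)) :=
    fun _ _ _ => rfl
  -- The components in `U` and in `C` can be separated at each generator, and a homomorphism is
  -- determined by its values at the generators.
  have hΦinj : Function.Injective Φ := by
    rw [injective_iff_map_eq_zero]
    rintro ⟨u, c⟩ h
    have h1 : ∀ i, (u i : V → K) + homPart c (θ (FreeGroup.of i)) = 0 := fun i => congrFun h i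
    have h2 : ∀ i, homPart c (θ (FreeGroup.of i)) = 0 := fun i => by
      have h3 : homPart c (θ (FreeGroup.of i)) ∈ U := by
        rw [← neg_eq_of_add_eq_zero_right (h1 i)]; exact U.neg_mem (u i).2
      exact Submodule.disjoint_def.1 hUC _ h3 (homPart_mem _ _)
    have h4 : ∀ g, homPart c g = 0 := by
      intro g
      obtain ⟨w, rfl⟩ := hθ g
      induction w using FreeGroup.induction_on with
      | C1 => simpa using homPart_mul c 1 1
      | of i => exact h2 i
      | inv_of i hi =>
        have := homPart_mul c (θ (FreeGroup.of i)) (θ (FreeGroup.of i)⁻¹)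
        have h1 : homPart c 1 = 0 := by simpa using homPart_mul c 1 1
        rw [← map_mul, mul_inv_cancel, map_one, h1, h2, zero_add] at this
        exact this.symm
      | mul x y hx hy => rw [map_mul, homPart_mul, hx, hy, add_zero]
    have h5 : c = 0 := by
      funext l
      ext x
      have h6 : ∑ l, (c l : V → K) x • b l = 0 := by
        refine AddMonoidHom.ext fun g => ?_
        have := congrFun (h4 g.toMul) x
        simpa [homPart, mul_comm] using this
      exact Fintype.linearIndependent_iff.1 b.linearIndependent _ h6 l
    have h6 : u = 0 := by
      funext i
      ext1
      simpa [h2] using h1 i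
    rw [h5, h6]; rfl
  have hrel : ∀ j, θ (R j) = 1 := fun j => by
    have : R j ∈ θ.ker := hR ▸ Subgroup.subset_normalClosure ⟨j, rfl⟩
    exact this
  -- Modulo `U` the derivation is a homomorphism that factors through `G`, so kills the relators.
  have hT : ∀ z j, (E.symm (Φ z)).1 (R j) ∈ U := by
    rintro ⟨u, c⟩ j
    have h := derivations.sub_hom_mem (E.symm (Φ (u, c))).2 hU hC (ψ c)
      (fun w => homPart_mem _ _) (fun i => ?_) (R j)
    · have h0 : ψ c (.ofMul (R j)) = 0 := by
        change homPart c (θ (R j)) = 0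
        rw [hrel]
        simpa using homPart_mul c 1 1
      rwa [h0, sub_zero] at h
    · rw [← derivations.freeEquiv_apply]
      change E (E.symm (Φ (u, c))) i - homPart c (θ (FreeGroup.of i)) ∈ U
      rw [LinearEquiv.apply_symm_apply, hΦ, add_sub_cancel_right]
      exact (u i).2
  let Ψ : ((Fin n → U) × (Fin B → C)) →ₗ[K] derivations K (π.comp θ) :=
    E.symm.toLinearMap.comp Φ
  have hΨinj : Function.Injective Ψ := E.symm.injective.comp hΦinj
  let T : ((Fin n → U) × (Fin B → C)) →ₗ[K] (Fin m → U) :=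
    LinearMap.pi fun j =>
      (((LinearMap.proj (R j)).comp (derivations K (π.comp θ)).subtype).comp Ψ).codRestrict U
        fun z => hT z j
  -- The derivations in the kernel of `T` vanish at all relators, so come from `G`.
  have hker : (LinearMap.ker T).map Ψ ≤ LinearMap.range (derivations.pullback (K := K) θ π) := by
    rintro _ ⟨z, hz, rfl⟩
    refine derivations.mem_range_pullback hθ hR _ ?_
    rintro _ ⟨j, rfl⟩
    exact congrArg Subtype.val (congrFun hz j)
  obtain ⟨L, hL⟩ := derivations.exists_injective (K := K) N hN hπ
  have hidx : N.FiniteIndex := by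
    have hk : N = π.ker := by ext g; exact hN g
    rw [hk]
    infer_instance
  have := Group.FG.finite_addMonoidHom N K
  have : Fintype V := Fintype.ofFinite V
  classical
  have hfin : Module.Finite K (derivations K π) := Module.Finite.of_injective L hL
  have d1 := LinearMap.finrank_le_finrank_of_injective hL
  have d2 := LinearMap.finrank_range_add_finrank_ker T
  have d3 := Submodule.finrank_le (LinearMap.range T)
  have d4 := Submodule.finrank_mono hker
  have d5 := LinearMap.finrank_range_le (derivations.pullback (K := K) θ π)
  rw [← (Submodule.equivMapOfInjective Ψ hΨinj _).finrank_eq] at d4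
  simp only [Module.finrank_prod, Module.finrank_pi_fintype, Finset.sum_const, Finset.card_univ,
    Fintype.card_fin, smul_eq_mul, Module.finrank_self, mul_one] at d1 d2 d3
  have hV : Fintype.card {v : V // v ≠ 0} + 1 = Nat.card V := by
    rw [Nat.card_eq_fintype_card, Fintype.card_subtype_compl]
    have : 0 < Fintype.card V := Fintype.card_pos
    simp; omega
  omega

/-! ### The first homology with coefficients in the prime field -/

theorem ULift.zmod_exists_natCast {p : ℕ} [NeZero p] (c : ULift (ZMod p)) :
    ∃ n : ℕ, (n : ULift (ZMod p)) = c :=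
  ⟨c.down.val, ULift.ext _ _ (ZMod.natCast_zmod_val c.down)⟩

theorem map_smul_of_ulift_zmod {p : ℕ} [NeZero p] {A B : Type*} [AddCommGroup A] [AddCommGroup B]
    [Module (ULift (ZMod p)) A] [Module (ULift (ZMod p)) B] (f : A →+ B) (c : ULift (ZMod p))
    (x : A) : f (c • x) = c • f x := by
  obtain ⟨n, rfl⟩ := ULift.zmod_exists_natCast c
  rw [Nat.cast_smul_eq_nsmul, Nat.cast_smul_eq_nsmul, map_nsmul]

open TensorProduct in
/-- `b₁(G; 𝔽_p) = dim Hom(G, 𝔽_p)`: the dual of `H₁(G; 𝔽_p) = Gᵃᵇ ⊗ 𝔽_p` is `Hom(G, 𝔽_p)`, and the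
finite ranks of a space and its dual agree even if they are infinite-dimensional. -/
theorem bettiOne_eq_finrank_hom.{u} (p : ℕ) [Fact p.Prime] (G : Type u) [Group G] :
    bettiOne p G = Module.finrank (ULift.{u} (ZMod p)) (Additive G →+ ULift.{u} (ZMod p)) := by
  let K := ULift.{u} (ZMod p)
  let A := Rep.trivial K G K
  let e : groupHomology.H1 A ≃+ Additive (Abelianization G) ⊗[ℤ] K :=
    groupHomology.H1AddEquivOfIsTrivial A
  let of : Additive G →+ Additive (Abelianization G) := MonoidHom.toAdditive Abelianization.of
  let res : Module.Dual K (groupHomology.H1 A) →ₗ[K] (Additive G →+ K) :=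
    { toFun := fun l =>
        { toFun := fun g => l (e.symm (of g ⊗ₜ (1 : K)))
          map_zero' := by simp
          map_add' := fun g h => by rw [map_add, TensorProduct.add_tmul, map_add, map_add] }
      map_add' := fun _ _ => rfl
      map_smul' := fun _ _ => rfl }
  have hinj : Function.Injective res := by
    rw [injective_iff_map_eq_zero]
    intro l hl
    have h : ∀ t, l (e.symm t) = 0 := by
      intro t
      induction t with
      | zero => simp
      | add x y hx hy => rw [map_add, map_add, hx, hy, add_zero]
      | tmul g c =>
        obtain ⟨n, rfl⟩ := ULift.zmod_exists_natCast c
        obtain ⟨g, rfl⟩ : ∃ g' : Additive G, of g' = g := QuotientGroup.mk_surjective g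
        have : (of g ⊗ₜ[ℤ] (n : K)) = n • (of g ⊗ₜ[ℤ] (1 : K)) := by
          rw [← TensorProduct.tmul_smul, nsmul_one]
        rw [this, map_nsmul, map_nsmul]
        have h0 : l (e.symm (of g ⊗ₜ (1 : K))) = 0 := DFunLike.congr_fun hl g
        rw [h0, smul_zero]
    refine LinearMap.ext fun x => ?_
    simpa using h (e x)
  have hsurj : Function.Surjective res := by
    intro φ
    let φ' : Additive (Abelianization G) →+ K :=
      MonoidHom.toAdditiveLeft (Abelianization.lift (AddMonoidHom.toMultiplicativeRight φ))
    let t : Additive (Abelianization G) ⊗[ℤ] K →ₗ[ℤ] K :=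
      TensorProduct.lift ((LinearMap.mul ℤ K).comp φ'.toIntLinearMap)
    let l : groupHomology.H1 A →+ K := t.toAddMonoidHom.comp e.toAddMonoidHom
    refine ⟨{ l with map_smul' := map_smul_of_ulift_zmod l }, ?_⟩
    refine AddMonoidHom.ext fun g => ?_
    change t (e (e.symm (of g ⊗ₜ (1 : K)))) = φ g
    rw [AddEquiv.apply_symm_apply]
    change φ' (of g) * 1 = φ g
    rw [mul_one]
    rfl
  rw [bettiOne, ← Subspace.dual_finrank_eq]
  exact (LinearEquiv.ofBijective res ⟨hinj, hsurj⟩).finrank_eq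

/-! ### The lower bound for the first Betti number -/

/-- The bound for one presentation, in natural numbers, with the negative terms moved across. -/
theorem bettiOne_subgroup_ge {G : Type*} [Group G] (P : FinitePresentation G)
    (p : ℕ) [Fact p.Prime] (r : ℕ) (N : Subgroup G) [N.Normal]
    (e : G ⧸ N ≃* Multiplicative (Fin r → ZMod p)) (k : ℕ) :
    P.n * ∑ j ∈ Finset.range k, omegaCard p r j + bettiOne p G * omegaCard p r k + 1
      ≤ bettiOne p N + p ^ r + P.m * ∑ j ∈ Finset.range k, omegaCard p r j := by
  let K := ULift.{_} (ZMod p)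
  have hK : Fintype.card K = p := by simp [K, ZMod.card]
  let e' : (Fin r → ZMod p) ≃+ (Fin r → K) :=
    AddEquiv.piCongrRight fun _ => AddEquiv.ulift.symm
  let f : G ⧸ N ≃* Multiplicative (Fin r → K) := e.trans (AddEquiv.toMultiplicative e')
  let π : G →* Multiplicative (Fin r → K) := f.toMonoidHom.comp (QuotientGroup.mk' N)
  have hπ : Function.Surjective π := f.surjective.comp (QuotientGroup.mk'_surjective N)
  have hN : ∀ g, g ∈ N ↔ π g = 1 := fun g => by
    change g ∈ N ↔ f (g : G ⧸ N) = 1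
    rw [map_eq_one_iff f f.injective, QuotientGroup.eq_one_iff]
  let θ : FreeGroup (Fin P.n) →* G :=
    P.equiv.toMonoidHom.comp (PresentedGroup.mk (Set.range P.relator))
  have hθ : Function.Surjective θ :=
    P.equiv.surjective.comp (PresentedGroup.mk_surjective _)
  have hR : θ.ker = Subgroup.normalClosure (Set.range P.relator) := by
    ext w
    change P.equiv (PresentedGroup.mk _ w) = 1 ↔ _
    rw [map_eq_one_iff P.equiv P.equiv.injective]
    exact QuotientGroup.eq_one_iff w
  have h := finrank_hom_subgroup_ge (K := K) hθ hR hπ hN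
    (U := polyLT (Fin r) K (Fintype.card K) k)
    (C := polyHomogeneous (Fin r) K (Fintype.card K) k)
    (fun h _ hf => translateFun_mem_polyLT K h hf)
    (fun h _ hf => translateFun_sub_mem_polyLT K h hf)
    (disjoint_polyLT_polyHomogeneous (Fin r) K k)
  have hU : Module.finrank K (polyLT (Fin r) K (Fintype.card K) k)
      = ∑ j ∈ Finset.range k, omegaCard p r j := by
    rw [sum_omegaCard_eq_card, polyLT, finrank_span_monomialFun, hK]
  have hC : Module.finrank K (polyHomogeneous (Fin r) K (Fintype.card K) k) = omegaCard p r k := by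
    rw [omegaCard_eq_card, polyHomogeneous, finrank_span_monomialFun, hK]
  have hV : Nat.card (Fin r → K) = p ^ r := by simp [Nat.card_eq_fintype_card, hK]
  rw [hU, hC, hV] at h
  rwa [bettiOne_eq_finrank_hom, bettiOne_eq_finrank_hom]

theorem theorem6p2 (G : Type*) [Group G] [Group.IsFinitelyPresented G] (d : ℤ)
    (hd : ((d : WithTop ℤ) : WithBot (WithTop ℤ)) ≤ groupDeficiency G) :
    (∀ (p : ℕ), p.Prime → ∀ (r : ℕ) (N : Subgroup G) [N.Normal],
      Nonempty (G ⧸ N ≃* Multiplicative (Fin r → ZMod p)) →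
        ∀ k : ℕ, k ≤ r * (p - 1) →
          (1 : ℤ) + (bettiOne p G : ℤ) * (omegaCard p r k : ℤ)
              + d * ∑ j ∈ Finset.range k, (omegaCard p r j : ℤ) - (p : ℤ) ^ r
            ≤ (bettiOne p N : ℤ)) ∧
    (∀ (r : ℕ) (N : Subgroup G) [N.Normal],
      Nonempty (G ⧸ N ≃* Multiplicative (Fin r → ZMod 2)) →
        ∀ k : ℕ, k ≤ r →
          (1 : ℤ) + (bettiOne 2 G : ℤ) * (r.choose k : ℤ)
              + d * ∑ j ∈ Finset.range k, (r.choose j : ℤ) - (2 : ℤ) ^ r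
            ≤ (bettiOne 2 N : ℤ)) := by
  obtain ⟨P, hP⟩ := (le_groupDeficiency_iff d).1 hd
  have main : ∀ (p : ℕ), p.Prime → ∀ (r : ℕ) (N : Subgroup G) [N.Normal],
      Nonempty (G ⧸ N ≃* Multiplicative (Fin r → ZMod p)) → ∀ k : ℕ,
          (1 : ℤ) + (bettiOne p G : ℤ) * (omegaCard p r k : ℤ)
              + d * ∑ j ∈ Finset.range k, (omegaCard p r j : ℤ) - (p : ℤ) ^ r
            ≤ (bettiOne p N : ℤ) := by
    rintro p hp r N _ ⟨e⟩ k
    have : Fact p.Prime := ⟨hp⟩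
    have h := bettiOne_subgroup_ge P p r N e k
    zify at h
    have hS : (0 : ℤ) ≤ ∑ j ∈ Finset.range k, (omegaCard p r j : ℤ) := by positivity
    have hd' := mul_le_mul_of_nonneg_right hP hS
    rw [FinitePresentation.deficiency, sub_mul] at hd'
    linarith
  refine ⟨fun p hp r N _ he k _ => main p hp r N he k, fun r N _ he k _ => ?_⟩
  have h := main 2 Nat.prime_two r N he k
  simp only [omegaCard_two] at h
  exact_mod_cast h
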